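/- Let $\Gamma$ be an infinite group generated by a finite set $X\subset\Gamma$, let $\mathbb F_X$ be the free group on $X$ and $\pi:\mathbb F_X\to\Gamma$ the canonical epimorphism. For $\omega\in\mathbb F_X$ let $|\omega|$ be the length of its freely reduced word, let $B_n=\{\omega\in\mathbb F_X:|\omega|\le n\}$, and for $g\in\Gamma$ let $|g|_\Gamma=\min\{|\omega|:\omega\in\mathbb F_X,\ \pi(\omega)=g\}$; for $\omega\in\mathbb F_X$ write $|\omega|_\Gamma:=|\pi(\omega)|_\Gamma$. A set $S\subset\mathbb F_X$ is called UB-generic (Upper Banach generic) if $$\limsup_{n\to\infty}\ \max_{\omega\in\mathbb F_X}\frac{|S\cap\omega B_n|}{|B_n|}=1 .$$ We say that $\Gamma$ has solvable Word Problem (WP) on $S\subset\mathbb F_X$ if there is a partial algorithm, with elements of $\mathbb F_X$ (as freely reduced words) as input, that stops at least on every $\omega\in S$ and that, whenever it stops on $\omega \in\mathbb F_X$, correctly decides whether $\pi(\omega)=1$; and that $\Gamma$ has solvable UB-generic WP with respect to $X$ if it has solvable WP on some UB-generic subset of $\mathbb F_X$. A sequence $\{\omega_n\}_{n\in\mathbb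 N}\subset\mathbb F_X$ is called computably enumerable if an algorithm computes $\omega_n$ from $n$. The following are equivalent: 1. $\Gamma$ has solvable UB-generic WP with respect to $X$; 2. there exists $S\subset\mathbb F_X$ computably enumerable, UB-generic and such that $S\cap\ker\pi=\emptyset$; 3. there exists a computably enumerable sequence $\{\omega_n\}_{n\in\mathbb N}\subset\mathbb F_X$ such that $|\omega_n|_\Gamma>n$ for all $n\in\mathbb N$; 4. there exists a computably enumerable sequence $\{\omega_n\}_{n\in\mathbb N}\subset\mathbb F_X$ such that $|\omega_{n+1}|_\Gamma>|\omega_n|_\Gamma$ for all $n\in\mathbb N$. -/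

import Mathlib

open Filter

noncomputable section

namespace UBGeneric

variable {Γ : Type*}

/-- The standard coding of a finite alphabet, through an enumeration of its letters. Any two
enumerations give the same computable functions on words, as they differ by a finite table. -/
instance alphabetPrimcodable (X : Finset Γ) : Primcodable X :=
  Primcodable.ofEquiv (Fin X.card) X.equivFin

/-- The canonical homomorphism `π` from the free group on `X` to `Γ`. -/
def proj [Group Γ] (X : Finset Γ) : FreeGroup X →* Γ :=
  FreeGroup.lift (fun x : X => (x : Γ))

open scoped Classical in
/-- The freely reduced word, over the alphabet `X ∪ X⁻¹`, of an element of the free group. This is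
what an algorithm reads or writes. -/
def redWord {X : Finset Γ} (w : FreeGroup X) : List (X × Bool) :=
  w.toWord

/-- The length `|w|` of an element of the free group. -/
def wordLength {X : Finset Γ} (w : FreeGroup X) : ℕ :=
  (redWord w).length

/-- The word length `|g|_Γ` of an element of `Γ` with respect to `X`. -/
def groupLength [Group Γ] (X : Finset Γ) (g : Γ) : ℕ :=
  sInf {n : ℕ | ∃ w : FreeGroup X, proj X w = g ∧ wordLength w = n}

/-- The ball `B_n` of radius `n` in the free group on `X`. -/
def ball (X : Finset Γ) (n : ℕ) : Set (FreeGroup X) :=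
  {w | wordLength w ≤ n}

/-- Balls are finite, so that counting their elements with `Set.ncard` is meaningful. -/
theorem ball_finite (X : Finset Γ) (n : ℕ) : (ball X n).Finite := by
  classical
  have hinj : Function.Injective (redWord (X := X)) := by
    intro a b h
    exact FreeGroup.toWord_injective h
  exact Set.Finite.preimage hinj.injOn (List.finite_length_le (X × Bool) n)

/-- The upper Banach density of `S`: the upper limit, over `n`, of the maximal proportion of `S`
in the left translates `w B_n` of the ball of radius `n`. -/
def upperBanachDensity {X : Finset Γ} (S : Set (FreeGroup X)) : ℝ :=
  limsup (fun n : ℕ => ⨆ w : FreeGroup X,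
    ((S ∩ (fun b => w * b) '' ball X n).ncard : ℝ) / ((ball X n).ncard : ℝ)) atTop

/-- Upper Banach generic subsets of the free group. -/
def IsUBGeneric {X : Finset Γ} (S : Set (FreeGroup X)) : Prop :=
  upperBanachDensity S = 1

/-- The Word Problem is solvable on `S`: there is a partial algorithm `f` that stops at least on the
elements of `S` and, whenever it stops on an element of the free group, correctly says whether that
element is trivial in `Γ`. -/
def SolvableWPOn [Group Γ] {X : Finset Γ} (S : Set (FreeGroup X)) : Prop :=
  ∃ f : List (X × Bool) →. Bool, Partrec f ∧
    (∀ w ∈ S, (f (redWord w)).Dom) ∧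
    ∀ (w : FreeGroup X) (b : Bool), b ∈ f (redWord w) → (b = true ↔ proj X w = 1)

/-- The group generated by `X` has solvable UB-generic Word Problem with respect to `X`. -/
def SolvableUBGenericWP [Group Γ] (X : Finset Γ) : Prop :=
  ∃ S : Set (FreeGroup X), IsUBGeneric S ∧ SolvableWPOn S

/-- Computably enumerable subsets of the free group. -/
def IsCESet {X : Finset Γ} (S : Set (FreeGroup X)) : Prop :=
  REPred fun L : List (X × Bool) => ∃ w ∈ S, redWord w = L

/-- Computably enumerable sequences of elements of the free group: an algorithm lists
`ω 0, ω 1, ω 2, …` in this order, that is, it computes `ω n` from `n`. -/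
def IsCESequence {X : Finset Γ} (ω : ℕ → FreeGroup X) : Prop :=
  Computable fun n => redWord (ω n)

end UBGeneric

end

/-! UB-genericity is thickness (`IsThick`): a set whose complement meets every translate of `B_n`
misses a fixed proportion of every larger ball (`IsUBGeneric.isThick`). Moreover `|ω|_Γ > n` says
exactly that `ω B_n` avoids `ker π` (`lt_groupLength_iff`), so sequences as in 3 are centres of
balls witnessing thickness off the kernel. Since `Γ` is infinite, deleting `ker π` preserves
thickness (`IsThick.diff_ker`); hence the inputs on which a partial algorithm answers "nontrivial"
form a thick c.e. set. Centres in a thick c.e. set are found by unbounded search, and conversely the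
union of the balls is c.e. Conditions 3 and 4 differ only by passing to a computable subsequence. -/

/-! ### Computability: unbounded search, stages, words. -/

theorem ComputablePred.exists_partrec_choice {α β : Type*} [Primcodable α] [Primcodable β]
    {P : α → β → Prop} (hP : ComputablePred fun p : α × β => P p.1 p.2) :
    ∃ f : α →. β, Partrec f ∧ (∀ a b, b ∈ f a → P a b) ∧ ∀ a, (f a).Dom ↔ ∃ b, P a b := by
  obtain ⟨hd, hc⟩ := hP
  have hd' : ∀ a b, Decidable (P a b) := fun a b => hd (a, b)
  let g : α → β → Option β := fun a b => bif decide (P a b) then some b else none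
  have hg : Computable₂ g :=
    Computable.cond (hc.of_eq fun p => by simp) (Computable.option_some.comp Computable.snd)
      (Computable.const none)
  let F : α → ℕ → Option β := fun a m => (Encodable.decode (α := β) m).bind (g a)
  have hF : Computable₂ F :=
    Computable.option_bind (Computable.decode.comp Computable.snd)
      (hg.comp (Computable.fst.comp Computable.fst) Computable.snd)
  have hgs : ∀ a b c, c ∈ g a b ↔ P a b ∧ b = c := by
    intro a b c
    by_cases h : P a b <;> simp [g, h]
  refine ⟨fun a => Nat.rfindOpt (F a), Partrec.rfindOpt hF, fun a b hb => ?_, fun a => ?_⟩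
  · obtain ⟨m, hm⟩ := Nat.rfindOpt_spec hb
    obtain ⟨c, -, hc⟩ := Option.bind_eq_some_iff.1 hm
    obtain ⟨h, rfl⟩ := (hgs a c b).1 hc
    exact h
  · rw [Nat.rfindOpt_dom]
    constructor
    · rintro ⟨m, b, hm⟩
      obtain ⟨c, -, hc⟩ := Option.bind_eq_some_iff.1 hm
      exact ⟨c, ((hgs a c b).1 hc).1⟩
    · rintro ⟨b, hb⟩
      exact ⟨Encodable.encode b, b,
        Option.bind_eq_some_iff.2 ⟨b, Encodable.encodek b, (hgs a b b).2 ⟨hb, rfl⟩⟩⟩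

theorem ComputablePred.rePred_exists {α β : Type*} [Primcodable α] [Primcodable β]
    {P : α → β → Prop} (hP : ComputablePred fun p : α × β => P p.1 p.2) :
    REPred fun a => ∃ b, P a b := by
  obtain ⟨f, hf, -, hdom⟩ := hP.exists_partrec_choice
  exact hf.dom_re.of_eq hdom

theorem ComputablePred.exists_computable_choice {α β : Type*} [Primcodable α] [Primcodable β]
    {P : α → β → Prop} (hP : ComputablePred fun p : α × β => P p.1 p.2)
    (h : ∀ a, ∃ b, P a b) : ∃ g : α → β, Computable g ∧ ∀ a, P a (g a) := by
  obtain ⟨f, hf, hs, hdom⟩ := hP.exists_partrec_choice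
  refine ⟨fun a => (f a).get ((hdom a).2 (h a)), hf.of_eq_tot fun a => Part.get_mem _,
    fun a => hs a _ (Part.get_mem _)⟩

/-- A recursively enumerable predicate is the increasing union of uniformly primitive recursive
stages. -/
theorem REPred.exists_stages {α : Type*} [Primcodable α] {p : α → Prop} (hp : REPred p) :
    ∃ R : α → ℕ → Prop, PrimrecRel R ∧ (∀ a k l, k ≤ l → R a k → R a l) ∧
      ∀ a, p a ↔ ∃ k, R a k := by
  obtain ⟨c, hc⟩ := Nat.Partrec.Code.exists_code.1 hp
  have hprim : Primrec fun x : α × ℕ =>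
      (Nat.Partrec.Code.evaln x.2 c (Encodable.encode x.1)).isSome :=
    Primrec.option_isSome.comp (Nat.Partrec.Code.primrec_evaln.comp
      (Primrec.pair (Primrec.pair Primrec.snd (Primrec.const c))
        (Primrec.encode.comp Primrec.fst)))
  refine ⟨fun a k => (Nat.Partrec.Code.evaln k c (Encodable.encode a)).isSome = true,
    ⟨inferInstance, hprim.of_eq fun x => by simp⟩, fun a k l hkl h => ?_, fun a => ?_⟩
  · obtain ⟨x, hx⟩ := Option.isSome_iff_exists.1 h
    exact Option.isSome_iff_exists.2 ⟨x, Nat.Partrec.Code.evaln_mono hkl hx⟩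
  · have h1 : p a ↔ (Nat.Partrec.Code.eval c (Encodable.encode a)).Dom := by
      rw [hc]
      simp [Part.assert]
    rw [h1, Part.dom_iff_mem]
    simp only [Nat.Partrec.Code.evaln_complete, Option.isSome_iff_exists]
    exact exists_comm

theorem FreeGroup.primrec_reduce {α : Type*} [Primcodable α] [DecidableEq α] :
    Primrec (FreeGroup.reduce : List (α × Bool) → List (α × Bool)) := by
  have hstep : Primrec₂ fun (_ : List (α × Bool))
      (q : (α × Bool) × List (α × Bool)) =>
      (List.casesOn q.2 [q.1] fun hd tl =>
        if q.1.1 = hd.1 ∧ q.1.2 = !hd.2 then tl else q.1 :: hd :: tl : List (α × Bool)) := by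
    refine Primrec.list_casesOn
      (h := fun (q : List (α × Bool) × ((α × Bool) × List (α × Bool)))
        (r : (α × Bool) × List (α × Bool)) =>
        if q.2.1.1 = r.1.1 ∧ q.2.1.2 = !r.1.2 then r.2 else q.2.1 :: r.1 :: r.2)
      (Primrec.snd.comp Primrec.snd)
      (Primrec.list_cons.comp (Primrec.fst.comp Primrec.snd) (Primrec.const [])) ?_
    have hx : Primrec fun z : ((List (α × Bool)) × ((α × Bool) × List (α × Bool))) ×
        ((α × Bool) × List (α × Bool)) => z.1.2.1 :=
      Primrec.fst.comp (Primrec.snd.comp Primrec.fst)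
    have hh : Primrec fun z : ((List (α × Bool)) × ((α × Bool) × List (α × Bool))) ×
        ((α × Bool) × List (α × Bool)) => z.2.1 := Primrec.fst.comp Primrec.snd
    have ht : Primrec fun z : ((List (α × Bool)) × ((α × Bool) × List (α × Bool))) ×
        ((α × Bool) × List (α × Bool)) => z.2.2 := Primrec.snd.comp Primrec.snd
    exact Primrec.ite
      ((Primrec.eq.comp (Primrec.fst.comp hx) (Primrec.fst.comp hh)).and
        (Primrec.eq.comp (Primrec.snd.comp hx) (Primrec.not.comp (Primrec.snd.comp hh))))
      ht (Primrec.list_cons.comp hx (Primrec.list_cons.comp hh ht))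
  refine (Primrec.list_foldr Primrec.id (Primrec.const []) hstep).of_eq fun L => ?_
  induction L with
  | nil => rfl
  | cons x L ih =>
    simp only [id, List.foldr_cons] at ih ⊢
    rw [ih, FreeGroup.reduce.cons]

/-- All words over the alphabet `l` of length at most `n`. -/
def List.wordsUpTo {α : Type*} (l : List α) (n : ℕ) : List (List α) :=
  n.rec [[]] fun _ W => [] :: l.flatMap fun a => W.map (List.cons a)

theorem List.mem_wordsUpTo {α : Type*} {l : List α} (hl : ∀ a, a ∈ l) {n : ℕ} {w : List α} :
    w ∈ l.wordsUpTo n ↔ w.length ≤ n := by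
  induction n generalizing w with
  | zero => simp [List.wordsUpTo]
  | succ n ih =>
    have h : l.wordsUpTo (n + 1) =
      [] :: l.flatMap fun a => (l.wordsUpTo n).map (List.cons a) := rfl
    rw [h]
    cases w with
    | nil => simp
    | cons a w => simp [ih, hl]

theorem List.primrec_wordsUpTo {α : Type*} [Primcodable α] (l : List α) :
    Primrec l.wordsUpTo := by
  refine Primrec.nat_rec₁ [[]] ?_
  refine Primrec.list_cons.comp (Primrec.const [])
    (Primrec.list_flatMap (Primrec.const l) ?_)
  exact Primrec.list_map (Primrec.snd.comp Primrec.fst)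
    (Primrec.list_cons.comp (Primrec.snd.comp Primrec.fst) Primrec.snd)

theorem REPred.and {α : Type*} [Primcodable α] {p q : α → Prop} (hp : REPred p)
    (hq : REPred q) : REPred fun a => p a ∧ q a := by
  have hq' : Partrec₂ fun (a : α) (_ : Unit) => Part.assert (q a) fun _ => Part.some () :=
    Partrec.comp hq Computable.fst
  exact (Partrec.bind hp hq').dom_re.of_eq fun a => by simp [Part.assert]

theorem REPred.comp {α β : Type*} [Primcodable α] [Primcodable β] {p : β → Prop}
    (hp : REPred p) {f : α → β} (hf : Computable f) : REPred fun a => p (f a) :=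
  Partrec.comp hp hf

theorem Partrec.rePred_false_mem {α : Type*} [Primcodable α] {f : α →. Bool} (hf : Partrec f) :
    REPred fun a => false ∈ f a := by
  have hg : Partrec₂ fun (_ : α) (b : Bool) => bif b then Part.none else Part.some () :=
    Partrec.cond Computable.snd Partrec.none (Computable.const ()).partrec
  refine (hf.bind hg).dom_re.of_eq fun a => ?_
  rw [Part.dom_iff_mem]
  simp only [Part.mem_bind_iff]
  constructor
  · rintro ⟨y, b, hb, hy⟩
    cases b
    · exact hb
    · exact absurd hy (Part.notMem_none _)
  · exact fun h => ⟨(), false, h, Part.mem_some _⟩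

/-! ### Balls, thickness and density in the free group. -/

namespace UBGeneric

variable {Γ : Type*} {X : Finset Γ}

theorem wordLength_one : wordLength (1 : FreeGroup X) = 0 := by
  classical
  simp [wordLength, redWord]

theorem wordLength_mul_le (u v : FreeGroup X) :
    wordLength (u * v) ≤ wordLength u + wordLength v := by
  classical
  exact FreeGroup.norm_mul_le u v

theorem wordLength_inv (u : FreeGroup X) : wordLength u⁻¹ = wordLength u := by
  classical
  exact FreeGroup.norm_inv_eq

theorem wordLength_mk_le (L : List (X × Bool)) : wordLength (FreeGroup.mk L) ≤ L.length := by
  classical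
  exact FreeGroup.norm_mk_le

theorem mk_redWord (w : FreeGroup X) : FreeGroup.mk (redWord w) = w := by
  classical
  exact FreeGroup.mk_toWord

theorem exists_mul_eq_of_mem_ball {k n : ℕ} {w : FreeGroup X} (hw : w ∈ ball X (k + n)) :
    ∃ u ∈ ball X k, ∃ v ∈ ball X n, u * v = w := by
  have hw' : (redWord w).length ≤ k + n := hw
  refine ⟨FreeGroup.mk ((redWord w).take k), (wordLength_mk_le _).trans (by simp),
    FreeGroup.mk ((redWord w).drop k), (wordLength_mk_le _).trans (by simp; omega), ?_⟩
  rw [FreeGroup.mul_mk, List.take_append_drop, mk_redWord]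

theorem one_mem_ball (n : ℕ) : (1 : FreeGroup X) ∈ ball X n := by
  simp [ball, wordLength_one]

theorem ball_ncard_pos (X : Finset Γ) (n : ℕ) : 0 < (ball X n).ncard :=
  (Set.ncard_pos (ball_finite X n)).2 ⟨1, one_mem_ball n⟩

theorem translate_finite (w : FreeGroup X) (n : ℕ) :
    ((fun b => w * b) '' ball X n).Finite :=
  (ball_finite X n).image _

theorem translate_ncard (w : FreeGroup X) (n : ℕ) :
    ((fun b => w * b) '' ball X n).ncard = (ball X n).ncard :=
  Set.ncard_image_of_injective _ (mul_right_injective w)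

theorem density_le_one (S : Set (FreeGroup X)) (n : ℕ) (w : FreeGroup X) :
    ((S ∩ (fun b => w * b) '' ball X n).ncard : ℝ) / ((ball X n).ncard : ℝ) ≤ 1 := by
  refine div_le_one_of_le₀ ?_ (Nat.cast_nonneg _)
  rw [← translate_ncard w n]
  exact_mod_cast Set.ncard_le_ncard Set.inter_subset_right (translate_finite w n)

theorem bddAbove_density (S : Set (FreeGroup X)) (n : ℕ) :
    BddAbove (Set.range fun w : FreeGroup X =>
      ((S ∩ (fun b => w * b) '' ball X n).ncard : ℝ) / ((ball X n).ncard : ℝ)) :=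
  ⟨1, by rintro _ ⟨w, rfl⟩; exact density_le_one S n w⟩

/-- A subset of the free group is thick if it contains left translates of all balls. -/
def IsThick (S : Set (FreeGroup X)) : Prop :=
  ∀ n : ℕ, ∃ v : FreeGroup X, ∀ b ∈ ball X n, v * b ∈ S

theorem IsThick.mono {S T : Set (FreeGroup X)} (hS : IsThick S) (h : S ⊆ T) : IsThick T := by
  intro n
  obtain ⟨v, hv⟩ := hS n
  exact ⟨v, fun b hb => h (hv b hb)⟩

theorem IsThick.isUBGeneric {S : Set (FreeGroup X)} (hS : IsThick S) : IsUBGeneric S := by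
  have h : (fun n : ℕ => ⨆ w : FreeGroup X,
      ((S ∩ (fun b => w * b) '' ball X n).ncard : ℝ) / ((ball X n).ncard : ℝ)) =
      fun _ => (1 : ℝ) := by
    funext n
    refine le_antisymm (ciSup_le (density_le_one S n)) ?_
    obtain ⟨v, hv⟩ := hS n
    refine le_ciSup_of_le (bddAbove_density S n) v ?_
    have hsub : S ∩ (fun b => v * b) '' ball X n = (fun b => v * b) '' ball X n := by
      rw [Set.inter_eq_right]
      rintro _ ⟨b, hb, rfl⟩
      exact hv b hb
    rw [hsub, translate_ncard, div_self]
    exact_mod_cast (ball_ncard_pos X n).ne'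
  rw [IsUBGeneric, upperBanachDensity, h, limsup_const]

/-- A covering argument: if every translate of `B_n` left `S`, each point of `w B_{k+n}` would be
determined by a nearby point of `w B_{k+n} \ S` and two elements of `B_n`. -/
theorem IsUBGeneric.isThick {S : Set (FreeGroup X)} (hS : IsUBGeneric S) : IsThick S := by
  intro n
  set c := (ball X n).ncard with hc
  have hc0 : (0 : ℝ) < c := by exact_mod_cast ball_ncard_pos X n
  -- `1 / c ^ 2` is the least proportion of a large ball that the complement could occupy, one
  -- factor `c` for each of the two elements of `B_n`.
  have hlt : 1 - 1 / (c : ℝ) ^ 2 < upperBanachDensity S := by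
    rw [hS]
    have : 0 < 1 / (c : ℝ) ^ 2 := by positivity
    linarith
  have hco : IsCoboundedUnder (· ≤ ·) atTop (fun m : ℕ => ⨆ w : FreeGroup X,
      ((S ∩ (fun b => w * b) '' ball X m).ncard : ℝ) / ((ball X m).ncard : ℝ)) := by
    refine IsBoundedUnder.isCoboundedUnder_le ⟨0, Filter.eventually_map.2 (.of_forall fun m => ?_)⟩
    exact Real.iSup_nonneg fun w => by positivity
  have hfreq := frequently_lt_of_lt_limsup hco hlt
  obtain ⟨m, hm, hmn⟩ := (hfreq.and_eventually (eventually_ge_atTop n)).exists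
  obtain ⟨k, rfl⟩ := Nat.exists_eq_add_of_le' hmn
  obtain ⟨w, hw⟩ := exists_lt_of_lt_ciSup hm
  by_contra! hbad
  set W := (fun b => w * b) '' ball X (k + n) with hW
  set D := W \ S with hD
  have hWfin : W.Finite := translate_finite w _
  have hDfin : D.Finite := hWfin.subset Set.sdiff_subset
  have hcover : ball X (k + n) ⊆
      (fun p : FreeGroup X × (FreeGroup X × FreeGroup X) => w⁻¹ * p.1 * p.2.1⁻¹ * p.2.2) ''
        (D ×ˢ (ball X n ×ˢ ball X n)) := by
    intro u hu
    -- Retreating to `u₁` of length at most `k` keeps the bad point `w * u₁ * b` inside `w B_{k+n}`.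
    obtain ⟨u₁, hu₁, u₂, hu₂, rfl⟩ := exists_mul_eq_of_mem_ball hu
    obtain ⟨b, hb, hbS⟩ := hbad (w * u₁)
    refine ⟨(w * u₁ * b, b, u₂), ⟨⟨⟨u₁ * b, ?_, (mul_assoc _ _ _).symm⟩, hbS⟩, hb, hu₂⟩, ?_⟩
    · exact (wordLength_mul_le _ _).trans (Nat.add_le_add hu₁ hb)
    · simp [mul_assoc]
  have hcard : (ball X (k + n)).ncard ≤ D.ncard * (c * c) := by
    have hfin := hDfin.prod ((ball_finite X n).prod (ball_finite X n))
    refine (Set.ncard_le_ncard hcover (hfin.image _)).trans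
      ((Set.ncard_image_le hfin).trans_eq ?_)
    rw [Set.ncard_prod, Set.ncard_prod]
  have hsum : (S ∩ W).ncard + D.ncard = (ball X (k + n)).ncard := by
    rw [Set.inter_comm, Set.ncard_inter_add_ncard_sdiff_eq_ncard _ _ hWfin, translate_ncard]
  have hM : (0 : ℝ) < (ball X (k + n)).ncard := by exact_mod_cast ball_ncard_pos X _
  have hcard' : ((ball X (k + n)).ncard : ℝ) ≤ D.ncard * (c * c) := by exact_mod_cast hcard
  have hsum' : ((S ∩ W).ncard : ℝ) + D.ncard = (ball X (k + n)).ncard := by exact_mod_cast hsum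
  rw [lt_div_iff₀ hM, ← hsum'] at hw
  rw [← hsum'] at hcard'
  have key : (D.ncard : ℝ) < 1 / (c : ℝ) ^ 2 * ((S ∩ W).ncard + D.ncard) := by linarith
  rw [one_div_mul_eq_div, lt_div_iff₀ (by positivity)] at key
  nlinarith

/-! ### Length in `Γ` and the kernel. -/

variable [Group Γ]

theorem proj_surjective (hX : Subgroup.closure (X : Set Γ) = ⊤) :
    Function.Surjective (proj X) := by
  rw [← MonoidHom.range_eq_top, proj, FreeGroup.range_lift_eq_closure]
  simpa using hX

theorem groupLength_proj_le (w : FreeGroup X) : groupLength X (proj X w) ≤ wordLength w :=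
  Nat.sInf_le ⟨w, rfl, rfl⟩

theorem exists_wordLength_eq_groupLength (w : FreeGroup X) :
    ∃ u : FreeGroup X, proj X u = proj X w ∧ wordLength u = groupLength X (proj X w) :=
  Nat.sInf_mem (s := {n : ℕ | ∃ u : FreeGroup X, proj X u = proj X w ∧ wordLength u = n})
    ⟨_, w, rfl, rfl⟩

theorem lt_groupLength_iff {n : ℕ} {w : FreeGroup X} :
    n < groupLength X (proj X w) ↔ ∀ b ∈ ball X n, proj X (w * b) ≠ 1 := by
  constructor
  · intro h b hb h1
    rw [map_mul, mul_eq_one_iff_eq_inv, ← map_inv] at h1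
    have h2 := groupLength_proj_le b⁻¹
    rw [← h1, wordLength_inv] at h2
    exact absurd (h.trans_le h2) (not_lt.2 hb)
  · intro h
    by_contra! hle
    obtain ⟨u, hu, hlen⟩ := exists_wordLength_eq_groupLength w
    refine h u⁻¹ (show wordLength u⁻¹ ≤ n by rw [wordLength_inv, hlen]; exact hle) ?_
    rw [map_mul, map_inv, hu, mul_inv_cancel]

/-- Pigeonhole: a finite `F ⊆ Γ` larger than `π(B_n)` has no left translate inside `π(B_n)`. Lifts
of `F` give a `K` independent of `v`, as `IsThick.diff_ker` needs. -/
theorem exists_radius_escape [Infinite Γ] (hX : Subgroup.closure (X : Set Γ) = ⊤) (n : ℕ) :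
    ∃ K : ℕ, ∀ v : FreeGroup X, ∃ u ∈ ball X K, n < groupLength X (proj X (v * u)) := by
  classical
  have hA : (proj X '' ball X n).Finite := (ball_finite X n).image _
  obtain ⟨F, hF⟩ := Infinite.exists_subset_card_eq Γ (hA.toFinset.card + 1)
  let lift := Function.surjInv (proj_surjective hX)
  have hlift : ∀ g, proj X (lift g) = g := Function.surjInv_eq _
  refine ⟨F.sup fun g => wordLength (lift g), fun v => ?_⟩
  by_contra! h
  have hsub : F.image (fun g => proj X v * g) ⊆ hA.toFinset := by
    intro x hx
    obtain ⟨g, hg, rfl⟩ := Finset.mem_image.1 hx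
    rw [Set.Finite.mem_toFinset]
    have h1 := h (lift g) (Finset.le_sup (f := fun g => wordLength (lift g)) hg)
    obtain ⟨u, hu, hlen⟩ := exists_wordLength_eq_groupLength (v * lift g)
    refine ⟨u, hlen.trans_le h1, ?_⟩
    rw [hu, map_mul, hlift]
  have hcard := Finset.card_le_card hsub
  rw [Finset.card_image_of_injective _ (mul_right_injective _), hF] at hcard
  omega

theorem IsThick.diff_ker [Infinite Γ] (hX : Subgroup.closure (X : Set Γ) = ⊤)
    {S : Set (FreeGroup X)} (hS : IsThick S) : IsThick (S \ ((proj X).ker : Set (FreeGroup X))) := by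
  intro n
  obtain ⟨K, hK⟩ := exists_radius_escape hX n
  obtain ⟨v, hv⟩ := hS (K + n)
  obtain ⟨u, hu, hlen⟩ := hK v
  refine ⟨v * u, fun b hb => ⟨?_, lt_groupLength_iff.1 hlen b hb⟩⟩
  rw [mul_assoc]
  exact hv _ ((wordLength_mul_le _ _).trans (Nat.add_le_add hu hb))

end UBGeneric

/-! ### Effective versions. -/

namespace UBGeneric

variable {Γ : Type*} {X : Finset Γ}

theorem primrec_redWord_mk :
    Primrec fun L : List (X × Bool) => redWord (FreeGroup.mk L) := by
  classical
  exact FreeGroup.primrec_reduce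

theorem redWord_injective : Function.Injective (redWord (X := X)) :=
  Function.LeftInverse.injective mk_redWord

/-- Computable reduction frees later arguments from handling reduced words only. -/
theorem isCESet_iff {S : Set (FreeGroup X)} :
    IsCESet S ↔ REPred fun L : List (X × Bool) => FreeGroup.mk L ∈ S := by
  constructor
  · intro h
    refine (h.comp primrec_redWord_mk.to_comp).of_eq fun L => ⟨?_, fun hL => ⟨_, hL, rfl⟩⟩
    rintro ⟨w, hw, heq⟩
    rwa [← redWord_injective heq]
  · intro h
    have hred : REPred fun L : List (X × Bool) => redWord (FreeGroup.mk L) = L :=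
      (Primrec.eq.comp primrec_redWord_mk Primrec.id).computablePred.to_re
    refine (h.and hred).of_eq fun L => ⟨fun hL => ⟨_, hL.1, hL.2⟩, ?_⟩
    rintro ⟨w, hw, rfl⟩
    rw [mk_redWord]
    exact ⟨hw, rfl⟩

theorem IsCESequence.comp {ω : ℕ → FreeGroup X} (hω : IsCESequence ω) {a : ℕ → ℕ}
    (ha : Computable a) : IsCESequence fun n => ω (a n) :=
  Computable.comp (f := fun n => redWord (ω n)) hω ha

theorem exists_stage_forall_mem {α : Type*} {R : α → ℕ → Prop}
    (hmono : ∀ a k l, k ≤ l → R a k → R a l) {W : List α} (h : ∀ a ∈ W, ∃ k, R a k) :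
    ∃ k, ∀ a ∈ W, R a k := by
  induction W with
  | nil => exact ⟨0, by simp⟩
  | cons a W ih =>
    obtain ⟨k, hk⟩ := ih fun b hb => h b (List.mem_cons_of_mem _ hb)
    obtain ⟨l, hl⟩ := h a List.mem_cons_self
    refine ⟨max k l, fun b hb => ?_⟩
    rcases List.mem_cons.1 hb with rfl | hb
    · exact hmono _ _ _ (le_max_right k l) hl
    · exact hmono _ _ _ (le_max_left k l) (hk b hb)

theorem IsThick.exists_isCESequence {S : Set (FreeGroup X)} (hS : IsThick S) (hce : IsCESet S) :
    ∃ ω : ℕ → FreeGroup X, IsCESequence ω ∧ ∀ n, ∀ b ∈ ball X n, ω n * b ∈ S := by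
  obtain ⟨R, hR, hmono, hRS⟩ := (isCESet_iff.1 hce).exists_stages
  let l : List (X × Bool) := Finset.univ.toList
  have hl : ∀ a, a ∈ l := fun a => Finset.mem_toList.2 (Finset.mem_univ a)
  -- Searching for a stage along with the centre makes the test decidable; one stage serves the
  -- whole finite ball by monotonicity.
  let P : ℕ → List (X × Bool) × ℕ → Prop := fun n p => ∀ b ∈ l.wordsUpTo n, R (p.1 ++ b) p.2
  have hP : ComputablePred fun q : ℕ × (List (X × Bool) × ℕ) => P q.1 q.2 := by
    have h1 : PrimrecRel fun (b : List (X × Bool)) (p : List (X × Bool) × ℕ) =>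
        R (p.1 ++ b) p.2 :=
      hR.comp (Primrec.list_append.comp (Primrec.fst.comp Primrec.snd) Primrec.fst)
        (Primrec.snd.comp Primrec.snd)
    exact (h1.forall_mem_list.comp ((List.primrec_wordsUpTo l).comp Primrec.fst)
      Primrec.snd).computablePred
  have hex : ∀ n, ∃ p, P n p := by
    intro n
    obtain ⟨v, hv⟩ := hS n
    obtain ⟨k, hk⟩ := exists_stage_forall_mem (R := fun b k => R (redWord v ++ b) k)
      (W := l.wordsUpTo n) (fun b => hmono _) fun b hb => by
        rw [← hRS, ← FreeGroup.mul_mk, mk_redWord]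
        exact hv _ ((wordLength_mk_le b).trans ((List.mem_wordsUpTo hl).1 hb))
    exact ⟨(redWord v, k), hk⟩
  obtain ⟨g, hg, hgP⟩ := hP.exists_computable_choice hex
  refine ⟨fun n => FreeGroup.mk (g n).1,
    primrec_redWord_mk.to_comp.comp (Computable.fst.comp hg), fun n b hb => ?_⟩
  have h := (hRS _).2 ⟨_, hgP n (redWord b) ((List.mem_wordsUpTo hl).2 hb)⟩
  rwa [← FreeGroup.mul_mk, mk_redWord] at h

theorem IsCESequence.isCESet_iUnion_ball {ω : ℕ → FreeGroup X} (hω : IsCESequence ω) :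
    IsCESet {w | ∃ n, ∃ b ∈ ball X n, ω n * b = w} := by
  rw [isCESet_iff]
  let T := List (X × Bool)
  -- The word of `ω n` is a free argument here, since `ω` is merely computable; it is substituted
  -- through `hmap`.
  have hQ : PrimrecPred fun q : (T × T) × (ℕ × T) =>
      redWord (FreeGroup.mk (q.1.1 ++ q.2.2)) = redWord (FreeGroup.mk q.1.2) ∧
        q.2.2.length ≤ q.2.1 :=
    (Primrec.eq.comp
      (primrec_redWord_mk.comp (Primrec.list_append.comp (Primrec.fst.comp Primrec.fst)
        (Primrec.snd.comp Primrec.snd)))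
      (primrec_redWord_mk.comp (Primrec.snd.comp Primrec.fst))).and
    (Primrec.nat_le.comp (Primrec.list_length.comp (Primrec.snd.comp Primrec.snd))
      (Primrec.fst.comp Primrec.snd))
  obtain ⟨hd, hQ⟩ := hQ.computablePred
  have hmap : Computable fun q : T × (ℕ × T) => ((redWord (ω q.2.1), q.1), q.2) :=
    ((Computable.comp hω (Computable.fst.comp Computable.snd)).pair Computable.fst).pair
      Computable.snd
  let P : T → ℕ × T → Prop := fun L p =>
    redWord (FreeGroup.mk (redWord (ω p.1) ++ p.2)) = redWord (FreeGroup.mk L) ∧ p.2.length ≤ p.1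
  have hP : ComputablePred fun q : T × (ℕ × T) => P q.1 q.2 :=
    ⟨fun q => hd ((redWord (ω q.2.1), q.1), q.2), hQ.comp hmap⟩
  refine hP.rePred_exists.of_eq fun L => ?_
  constructor
  · rintro ⟨⟨n, b⟩, heq, hlen⟩
    refine ⟨n, FreeGroup.mk b, (wordLength_mk_le b).trans hlen, ?_⟩
    rw [← redWord_injective heq, ← FreeGroup.mul_mk, mk_redWord]
  · rintro ⟨n, b, hb, heq⟩
    refine ⟨(n, redWord b), ?_, hb⟩
    rw [← heq, ← FreeGroup.mul_mk, mk_redWord, mk_redWord]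

variable [Group Γ]

theorem exists_isCESet_of_solvableWPOn {S : Set (FreeGroup X)} (hS : SolvableWPOn S) :
    ∃ T : Set (FreeGroup X), IsCESet T ∧ T ∩ ((proj X).ker : Set (FreeGroup X)) = ∅ ∧
      S \ ((proj X).ker : Set (FreeGroup X)) ⊆ T := by
  obtain ⟨f, hf, hdom, hcorrect⟩ := hS
  refine ⟨{w | false ∈ f (redWord w)},
    isCESet_iff.2 (hf.rePred_false_mem.comp primrec_redWord_mk.to_comp), ?_, ?_⟩
  · rw [Set.eq_empty_iff_forall_notMem]
    rintro w ⟨hw, hker⟩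
    exact Bool.false_ne_true ((hcorrect w false hw).2 hker)
  · rintro w ⟨hw, hker⟩
    obtain ⟨b, hb⟩ := Part.dom_iff_mem.1 (hdom w hw)
    cases b
    · exact hb
    · exact absurd ((hcorrect w true hb).1 rfl) hker

theorem IsCESet.solvableWPOn {S : Set (FreeGroup X)} (hS : IsCESet S)
    (hker : S ∩ ((proj X).ker : Set (FreeGroup X)) = ∅) : SolvableWPOn S := by
  refine ⟨_, Partrec.map (g := fun _ _ => false) hS (Computable.const false), ?_, ?_⟩
  · intro w hw
    exact ⟨⟨w, hw, rfl⟩, trivial⟩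
  · intro w b hb
    obtain ⟨_, hy, rfl⟩ := (Part.mem_map_iff _).1 hb
    obtain ⟨⟨u, hu, heq⟩, -⟩ := Part.mem_assert_iff.1 hy
    rw [redWord_injective heq] at hu
    refine iff_of_false Bool.false_ne_true fun h1 => ?_
    exact (Set.eq_empty_iff_forall_notMem.1 hker w) ⟨hu, h1⟩

theorem exists_isCESequence_strictly_increasing {ω : ℕ → FreeGroup X} (hω : IsCESequence ω)
    (h : ∀ n, n < groupLength X (proj X (ω n))) :
    ∃ τ : ℕ → FreeGroup X, IsCESequence τ ∧
      ∀ n, groupLength X (proj X (τ n)) < groupLength X (proj X (τ (n + 1))) := by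
  -- The computable `wordLength` replaces `groupLength`, which it bounds above.
  let a : ℕ → ℕ := fun n => n.rec 0 fun _ i => wordLength (ω i)
  have ha : Computable a := by
    refine Computable.nat_rec (h := fun _ p => wordLength (ω p.2)) Computable.id (Computable.const 0) ?_
    exact Computable.list_length.comp
      (Computable.comp (f := fun n => redWord (ω n)) hω (Computable.snd.comp Computable.snd))
  exact ⟨fun n => ω (a n), hω.comp ha,
    fun n => (groupLength_proj_le _).trans_lt (h (wordLength (ω (a n))))⟩

end UBGeneric

/-! ### The equivalences. -/

theorem mainTheorem2 {Γ : Type*} [Group Γ] [Infinite Γ] (X : Finset Γ)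
    (hX : Subgroup.closure (X : Set Γ) = ⊤) :
    List.TFAE [
      UBGeneric.SolvableUBGenericWP X,
      ∃ S : Set (FreeGroup X), UBGeneric.IsCESet S ∧ UBGeneric.IsUBGeneric S ∧
        S ∩ ((UBGeneric.proj X).ker : Set (FreeGroup X)) = ∅,
      ∃ ω : ℕ → FreeGroup X, UBGeneric.IsCESequence ω ∧
        ∀ n : ℕ, n < UBGeneric.groupLength X (UBGeneric.proj X (ω n)),
      ∃ ω : ℕ → FreeGroup X, UBGeneric.IsCESequence ω ∧
        ∀ n : ℕ, UBGeneric.groupLength X (UBGeneric.proj X (ω n)) <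
          UBGeneric.groupLength X (UBGeneric.proj X (ω (n + 1)))] := by
  tfae_have 1 → 2 := by
    rintro ⟨S, hgen, hWP⟩
    obtain ⟨T, hce, hker, hsub⟩ := UBGeneric.exists_isCESet_of_solvableWPOn hWP
    exact ⟨T, hce, ((hgen.isThick.diff_ker hX).mono hsub).isUBGeneric, hker⟩
  tfae_have 2 → 1 := by
    rintro ⟨S, hce, hgen, hker⟩
    exact ⟨S, hgen, hce.solvableWPOn hker⟩
  tfae_have 2 → 3 := by
    rintro ⟨S, hce, hgen, hker⟩
    obtain ⟨ω, hω, hS⟩ := hgen.isThick.exists_isCESequence hce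
    refine ⟨ω, hω, fun n => UBGeneric.lt_groupLength_iff.2 fun b hb h1 => ?_⟩
    exact Set.eq_empty_iff_forall_notMem.1 hker _ ⟨hS n b hb, h1⟩
  tfae_have 3 → 2 := by
    rintro ⟨ω, hω, h⟩
    refine ⟨_, hω.isCESet_iUnion_ball, UBGeneric.IsThick.isUBGeneric fun n =>
      ⟨ω n, fun b hb => ⟨n, b, hb, rfl⟩⟩, ?_⟩
    rw [Set.eq_empty_iff_forall_notMem]
    rintro _ ⟨⟨n, b, hb, rfl⟩, hker⟩
    exact UBGeneric.lt_groupLength_iff.1 (h n) b hb hker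
  tfae_have 3 → 4 := by
    rintro ⟨ω, hω, h⟩
    exact UBGeneric.exists_isCESequence_strictly_increasing hω h
  tfae_have 4 → 3 := by
    rintro ⟨ω, hω, h⟩
    -- The shift is needed because `ω 0` may have length `0` in `Γ`.
    refine ⟨fun n => ω (n + 1), hω.comp Computable.succ, fun n => ?_⟩
    induction n with
    | zero => exact (Nat.zero_le _).trans_lt (h 0)
    | succ n ih => exact (Nat.succ_le_of_lt ih).trans_lt (h (n + 1))
  tfae_finish
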